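/- **Setting.** Let $\sim$ be an adjacency relation on a set of databases and let $\Omega$ be a measurable space. A randomized algorithm $M$ reads an infinite sequence $H=(\eta_1,\eta_2,\dots)\in\mathbb R^\infty$ of real noise variables. On input $D$ and noise $H$ it either does not terminate, or it outputs some $M(D,H)\in\Omega$ after having used only a finite prefix $(\eta_1,\dots,\eta_m)$ of $H$; the output and the number $m$ are measurable in $H$. Let $P$ be the law of $H$. $M$ is $\varepsilon$-differentially private if $\Pr[M(D,H)\in E]\le e^{\varepsilon}\Pr[M(D',H)\in E]$ for all $D\sim D'$ and all measurable $E\subseteq\Omega$. Assume that for every $D$ the algorithm terminates with probability one, and that the number of noise variables used is determined by the output. **(A)** Let $\varepsilon>0$. Suppose the $\eta_i$ are independent and $\eta_i$ has a density (with respect to Lebesgue measure) or a probability mass function $f_i$, with a constant $c_i$ such that $$\ln\frac{f_i(x)}{f_i(y)}\le c_i|x-y|\qquad\text{for all }x,y\text{ in the domain }\{f_i>0\}.$$ Let $S_{D:\omega}$ be the set of noise sequences $H$ with $f_i(\eta_i)>0$ for all $i$ and $M(D,H)=\omega$. Suppose that for every pair $D\sim D'$ and every $\omega\in\Omega$ there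 is a map $\phi_\omega:\mathbb R^\infty\to\mathbb R^\infty$ (depending on $D,D',\omega$) such that, writing $\phi_\omega(H)=(\eta'_1,\eta'_2,\dots)$: 1. (local alignment) $\phi_\omega(S_{D:\omega})\subseteq S_{D':\omega}$; 2. (acyclic) there are a permutation $\pi$ of the indices, a constant $\psi_1$ and piecewise differentiable functions $\psi_j:\mathbb R^{j-1}\to\mathbb R$ ($j\ge2$) with $\eta'_{\pi(1)}=\eta_{\pi(1)}+\psi_1$ and $\eta'_{\pi(j)}=\eta_{\pi(j)}+\psi_j(\eta_{\pi(1)},\dots,\eta_{\pi(j-1)})$ for all $H\in\mathbb R^\infty$; here piecewise differentiable means that $\mathbb R^{j-1}$ is covered by countably many measurable pieces on each of which $\psi_j$ is differentiable; 3. (cost) $\sum_i c_i|\eta_i-\eta'_i|\le\varepsilon$ for all $H\in S_{D:\omega}$; and that for each pair $D\sim D'$ the set $\{\phi_\omega\mid\omega\in\Omega\}$ is countable and the outputs sharing one alignment form a measurable subset of $\Omega$. Then $M$ is $\varepsilon$-differentially private. **(B)** Now let the law of $H$ be arbitrary, and suppose that for every $n$ the vector $(\eta_1,\dots,\eta_n)$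 has a density $p_n$ on $\mathbb R^n$. Let $S^n_{D:\omega}$ be the set of vectors $h\in\mathbb R^n$ with $p_n(h)>0$ such that $M$, on input $D$ and noise starting with $h$, outputs $\omega$ and uses exactly the $n$ variables in $h$. Let $a,b>0$. Suppose that for every pair $D\sim D'$ and every $\omega\in\Omega$ there is a length-preserving map $\phi_\omega$ of finite noise vectors such that for every $n$: 1. $\phi_\omega$ maps $S^n_{D:\omega}$ into $S^n_{D':\omega}$ and is one-to-one there; 2. for almost every $h$ (with respect to the law of $(\eta_1,\dots,\eta_n)$), for all $\omega$ with $h\in S^n_{D:\omega}$: $p_n(h)/p_n(\phi_\omega(h))\le a$; 3. for almost every $h$ in the same sense, for all $\omega$ with $h\in S^n_{D:\omega}$: $\phi_\omega|_{\mathbb R^n}$ is differentiable at $h$, with Jacobian satisfying $|\det J_{\phi_\omega}(h)|\ge b$; and that for each pair $D\sim D'$ the set $\{\phi_\omega\mid\omega\in\Omega\}$ is countable and the outputs sharing one alignment form a measurable subset of $\Omega$ (for instance, a single map $\phi_\omega=\phi$ may serve for all $\omega$). Then $M$ is $\ln(a/b)$-differentially private. If instead each $(\eta_1,\dots,\eta_n)$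 is discrete with probability mass function $p_n$, the same holds without condition 3 and with $b=1$, that is, $M$ is $\ln(a)$-differentially private. -/

import Mathlib

open MeasureTheory Set

/-- A randomized algorithm on databases `DB` with output space `Ω`. Its source of randomness is an
infinite sequence of real noise variables `H`. `run D H = none` means that the execution on the
database `D` with noise `H` does not terminate; `run D H = some (ω, m)` means that it terminates
with output `ω` after having used the first `m` noise variables. An execution that has used only
the first `m` variables runs identically on any noise sequence with the same first `m` entries. -/
structure RandAlg (DB : Type*) (Ω : Type*) [MeasurableSpace Ω] where
  run : DB → (ℕ → ℝ) → Option (Ω × ℕ)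
  run_congr : ∀ (D : DB) (H H' : ℕ → ℝ) (ω : Ω) (m : ℕ), run D H = some (ω, m) →
    (∀ i < m, H' i = H i) → run D H' = some (ω, m)
  measurableSet_run : ∀ (D : DB) (E : Set Ω) (m : ℕ), MeasurableSet E →
    MeasurableSet {H : ℕ → ℝ | ∃ ω ∈ E, run D H = some (ω, m)}

namespace RandAlg

variable {DB Ω : Type*} [MeasurableSpace Ω]

/-- `M(D, H) = ω`. -/
def Outputs (M : RandAlg DB Ω) (D : DB) (H : ℕ → ℝ) (ω : Ω) : Prop :=
  ∃ m : ℕ, M.run D H = some (ω, m)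

/-- `M` terminates with probability one on every database, when the noise has law `P`. -/
def Terminates (M : RandAlg DB Ω) (P : Measure (ℕ → ℝ)) : Prop :=
  ∀ D : DB, ∀ᵐ H ∂P, ∃ ω : Ω, M.Outputs D H ω

/-- The number of noise variables used by `M` is a function of its output alone. -/
def CountDetermined (M : RandAlg DB Ω) : Prop :=
  ∃ N : Ω → ℕ, ∀ (D : DB) (H : ℕ → ℝ) (ω : Ω) (m : ℕ), M.run D H = some (ω, m) → m = N ω

/-- Pure `ε`-differential privacy with respect to the adjacency relation `adj`, when the noise has
law `P`. -/
def IsDP (M : RandAlg DB Ω) (P : Measure (ℕ → ℝ)) (adj : DB → DB → Prop) (ε : ℝ) : Prop :=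
  ∀ D D' : DB, adj D D' → ∀ E : Set Ω, MeasurableSet E →
    P {H | ∃ ω ∈ E, M.Outputs D H ω} ≤
      ENNReal.ofReal (Real.exp ε) * P {H | ∃ ω ∈ E, M.Outputs D' H ω}

end RandAlg

/-- The measure `μ` has the density `f` with respect to Lebesgue measure. -/
def HasDensity {X : Type*} [MeasureSpace X] (μ : Measure X) (f : X → ℝ) : Prop :=
  (∀ x, 0 ≤ f x) ∧ Measurable f ∧ μ = volume.withDensity (fun x => ENNReal.ofReal (f x))

/-- The measure `μ` is discrete with mass function `f`. -/
def HasMass {X : Type*} [MeasurableSpace X] (μ : Measure X) (f : X → ℝ) : Prop :=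
  (∀ x, 0 ≤ f x) ∧ (Function.support f).Countable ∧ μ (Function.support f)ᶜ = 0 ∧
    ∀ x, μ {x} = ENNReal.ofReal (f x)

/-! ### Alignments of infinite noise sequences -/

/-- A noise sequence is valid if each entry lies in the domain (the support) of its distribution. -/
def ValidNoise (f : ℕ → ℝ → ℝ) : Set (ℕ → ℝ) :=
  {H | ∀ i, 0 < f i (H i)}

/-- The set `S_{D:ω}` of valid noise sequences with which `M` on input `D` outputs `ω`. -/
def noiseSet {DB Ω : Type*} [MeasurableSpace Ω] (M : RandAlg DB Ω) (f : ℕ → ℝ → ℝ)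
    (D : DB) (ω : Ω) : Set (ℕ → ℝ) :=
  {H | H ∈ ValidNoise f ∧ M.Outputs D H ω}

/-- `φ` restricts to a local alignment `S_{D:ω} → S_{D':ω}`. -/
def IsLocalAlignment {DB Ω : Type*} [MeasurableSpace Ω] (M : RandAlg DB Ω) (f : ℕ → ℝ → ℝ)
    (D D' : DB) (ω : Ω) (φ : (ℕ → ℝ) → (ℕ → ℝ)) : Prop :=
  MapsTo φ (noiseSet M f D ω) (noiseSet M f D' ω)

/-- `g` is piecewise differentiable: its domain is covered by countably many measurable pieces on
each of which `g` is differentiable. -/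
def PiecewiseDifferentiable {n : ℕ} (g : (Fin n → ℝ) → ℝ) : Prop :=
  ∃ A : ℕ → Set (Fin n → ℝ), (∀ k, MeasurableSet (A k)) ∧ (⋃ k, A k) = univ ∧
    ∀ k, DifferentiableOn ℝ g (A k)

/-- `φ` is acyclic: after a reordering `π` of the variables, every entry of `φ H` is the
corresponding entry of `H` plus a piecewise differentiable function of the entries that come
earlier in the ordering (a constant for the first one, as `ψ 0` has no arguments). -/
def IsAcyclic (φ : (ℕ → ℝ) → (ℕ → ℝ)) : Prop :=
  ∃ (π : Equiv.Perm ℕ) (ψ : (j : ℕ) → (Fin j → ℝ) → ℝ),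
    (∀ j, PiecewiseDifferentiable (ψ j)) ∧
    ∀ (H : ℕ → ℝ) (j : ℕ), φ H (π j) = H (π j) + ψ j (fun k : Fin j => H (π k))

/-- The alignment cost `∑ i, c i * |η i - η' i|` of replacing the noise `H` by `H'`. -/
noncomputable def alignCost (c : ℕ → ℝ) (H H' : ℕ → ℝ) : ENNReal :=
  ∑' i, ENNReal.ofReal (c i * |H i - H' i|)

/-- Only countably many distinct alignments occur in the family `φ`, and the outputs that share
an alignment form a measurable set. -/
def CountablyManyAlignments {Ω A : Type*} [MeasurableSpace Ω] (φ : Ω → A) : Prop :=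
  (range φ).Countable ∧ ∀ α : A, MeasurableSet {ω | φ ω = α}

/-! ### Alignments of the finite vectors of used noise variables -/

/-- The vector of the first `n` noise variables. -/
def firstVars (n : ℕ) (H : ℕ → ℝ) : Fin n → ℝ := fun i => H i

/-- A noise sequence that starts with `h` (which continuation is chosen is irrelevant for an
execution that uses `n` variables). -/
def extendNoise {n : ℕ} (h : Fin n → ℝ) : ℕ → ℝ :=
  fun i => if hi : i < n then h ⟨i, hi⟩ else 0

/-- The valid vectors `h` of `n` noise variables (`p n` being the density or mass function of the
first `n` variables) on which `M` with input `D` outputs `ω` and uses exactly these `n`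
variables. -/
def usedNoiseSet {DB Ω : Type*} [MeasurableSpace Ω] (M : RandAlg DB Ω)
    (p : (n : ℕ) → (Fin n → ℝ) → ℝ) (D : DB) (ω : Ω) (n : ℕ) : Set (Fin n → ℝ) :=
  {h | 0 < p n h ∧ M.run D (extendNoise h) = some (ω, n)}

/-- An alignment of the used variables maps finite noise vectors to noise vectors of the same
length. -/
abbrev VecAlignment : Type := (n : ℕ) → (Fin n → ℝ) → (Fin n → ℝ)

/-- For the pair `D, D'`, the maps `φ ω` are one-to-one local alignments, only countably many of
which are distinct, and almost surely the density (or mass) decreases at most by the factor `a`. -/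
def IsAlignmentFamily {DB Ω : Type*} [MeasurableSpace Ω] (M : RandAlg DB Ω)
    (P : Measure (ℕ → ℝ)) (p : (n : ℕ) → (Fin n → ℝ) → ℝ) (D D' : DB) (a : ℝ)
    (φ : Ω → VecAlignment) : Prop :=
  (∀ ω n, MapsTo (φ ω n) (usedNoiseSet M p D ω n) (usedNoiseSet M p D' ω n)) ∧
  (∀ ω n, InjOn (φ ω n) (usedNoiseSet M p D ω n)) ∧
  (∀ n, ∀ᵐ h ∂(P.map (firstVars n)), ∀ ω, h ∈ usedNoiseSet M p D ω n →
    p n h / p n (φ ω n h) ≤ a) ∧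
  CountablyManyAlignments φ

/-- Almost surely, the alignment is differentiable and the absolute value of its Jacobian
determinant is at least `b`. -/
def JacobianBound {DB Ω : Type*} [MeasurableSpace Ω] (M : RandAlg DB Ω)
    (P : Measure (ℕ → ℝ)) (p : (n : ℕ) → (Fin n → ℝ) → ℝ) (D : DB) (b : ℝ)
    (φ : Ω → VecAlignment) : Prop :=
  ∀ n, ∀ᵐ h ∂(P.map (firstVars n)), ∀ ω, h ∈ usedNoiseSet M p D ω n →
    ∃ J : (Fin n → ℝ) →L[ℝ] (Fin n → ℝ), HasFDerivAt (φ ω n) J h ∧ b ≤ |J.det|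

open scoped ENNReal

/-! ### Decomposition of an execution by alignment and by number of used variables -/

/-- A bound between output probabilities may be checked separately for every alignment and every
number of used noise variables. -/
lemma RandAlg.measure_outputs_le {DB Ω A : Type*} [MeasurableSpace Ω] (M : RandAlg DB Ω)
    (P : Measure (ℕ → ℝ)) (D D' : DB) (C : ℝ≥0∞) {φ : Ω → A} (hφ : CountablyManyAlignments φ)
    (h : ∀ (α : A) (n : ℕ) (E : Set Ω), MeasurableSet E → (∀ ω ∈ E, φ ω = α) →
      P {H | ∃ ω ∈ E, M.run D H = some (ω, n)} ≤ C * P {H | ∃ ω ∈ E, M.run D' H = some (ω, n)})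
    {E : Set Ω} (hE : MeasurableSet E) :
    P {H | ∃ ω ∈ E, M.Outputs D H ω} ≤ C * P {H | ∃ ω ∈ E, M.Outputs D' H ω} := by
  have : Countable (range φ) := hφ.1.to_subtype
  let B : DB → range φ × ℕ → Set (ℕ → ℝ) := fun D i =>
    {H | ∃ ω ∈ E ∩ {ω | φ ω = i.1}, M.run D H = some (ω, i.2)}
  have hU : ∀ D, {H | ∃ ω ∈ E, M.Outputs D H ω} = ⋃ i, B D i := by
    intro D
    ext H
    simp only [mem_ofPred_eq, mem_iUnion, B]
    constructor
    · rintro ⟨ω, hω, m, hm⟩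
      exact ⟨(⟨φ ω, mem_range_self ω⟩, m), ω, ⟨hω, rfl⟩, hm⟩
    · rintro ⟨i, ω, hω, hm⟩
      exact ⟨ω, hω.1, i.2, hm⟩
  have hdisj : Pairwise (Function.onFun Disjoint (B D')) := by
    rintro ⟨α, m⟩ ⟨β, n⟩ hne
    refine Set.disjoint_left.2 ?_
    rintro H ⟨ω, hω, h1⟩ ⟨ω', hω', h2⟩
    rw [h1, Option.some.injEq, Prod.mk.injEq] at h2
    obtain ⟨rfl, h2⟩ := h2
    refine hne (Prod.ext (Subtype.ext ?_) h2)
    exact hω.2.symm.trans hω'.2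
  have hmeas : ∀ i, MeasurableSet (B D' i) := fun i =>
    M.measurableSet_run D' _ _ (hE.inter (hφ.2 _))
  rw [hU, hU, measure_iUnion hdisj hmeas, ← ENNReal.tsum_mul_left]
  refine (measure_iUnion_le _).trans (ENNReal.tsum_le_tsum fun i => ?_)
  exact h i.1 i.2 _ (hE.inter (hφ.2 _)) fun ω hω => hω.2

/-! ### Measures with a density or a mass function -/

lemma HasMass.measurable {X : Type*} [MeasurableSpace X] [MeasurableSingletonClass X]
    {μ : Measure X} {f : X → ℝ} (h : HasMass μ f) : Measurable f := by
  refine (measurable_const (a := (0 : ℝ))).measurable_of_countable_ne (h.2.1.mono ?_)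
  intro x hx
  exact Ne.symm hx

lemma HasMass.lintegral_eq {X : Type*} [MeasurableSpace X] [MeasurableSingletonClass X]
    {μ : Measure X} {f : X → ℝ} (h : HasMass μ f) (g : X → ℝ≥0∞) :
    ∫⁻ x, g x ∂μ = ∑' x : Function.support f, g x * ENNReal.ofReal (f x) := by
  have hr : μ.restrict (Function.support f) = μ :=
    Measure.restrict_eq_self_of_ae_mem (by rw [ae_iff]; exact h.2.2.1)
  conv_lhs => rw [← hr]
  rw [lintegral_countable _ h.2.1]
  simp_rw [h.2.2.2]

lemma HasMass.measure_eq {X : Type*} [MeasurableSpace X] [MeasurableSingletonClass X]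
    {μ : Measure X} {f : X → ℝ} (h : HasMass μ f) {s : Set X} (hs : s ⊆ Function.support f) :
    μ s = ∑' x : s, ENNReal.ofReal (f x) := by
  rw [← setLIntegral_one, lintegral_countable _ (h.2.1.mono hs)]
  simp_rw [h.2.2.2, one_mul]

lemma HasDensity.ae_pos {X : Type*} [MeasureSpace X] {μ : Measure X} {f : X → ℝ}
    (h : HasDensity μ f) : ∀ᵐ x ∂μ, 0 < f x := by
  rw [h.2.2, ae_withDensity_iff h.2.1.ennreal_ofReal]
  exact ae_of_all _ fun x hx => by simpa using hx

lemma HasMass.ae_pos {X : Type*} [MeasurableSpace X] {μ : Measure X} {f : X → ℝ}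
    (h : HasMass μ f) : ∀ᵐ x ∂μ, 0 < f x := by
  have : ∀ᵐ x ∂μ, x ∈ Function.support f := by rw [ae_iff]; exact h.2.2.1
  filter_upwards [this] with x hx
  exact lt_of_le_of_ne (h.1 x) (Ne.symm hx)

/-- Translating noise with a density, reweighted by the ratio of densities, does not increase
integrals. -/
lemma HasDensity.lintegral_translate_le {μ : Measure ℝ} {f : ℝ → ℝ} (h : HasDensity μ f) (t : ℝ)
    {g : ℝ → ℝ≥0∞} (hg : Measurable g) :
    ∫⁻ x, ENNReal.ofReal (f (x + t) / f x) * g (x + t) ∂μ ≤ ∫⁻ x, g x ∂μ := by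
  have hf := h.2.1
  rw [h.2.2, lintegral_withDensity_eq_lintegral_mul _ hf.ennreal_ofReal (by fun_prop),
    lintegral_withDensity_eq_lintegral_mul _ hf.ennreal_ofReal hg,
    ← lintegral_add_right_eq_self ((fun x => ENNReal.ofReal (f x)) * g) t]
  refine lintegral_mono fun x => ?_
  simp only [Pi.mul_apply, ← mul_assoc]
  gcongr
  rw [← ENNReal.ofReal_mul (h.1 x)]
  refine ENNReal.ofReal_le_ofReal ?_
  rcases eq_or_ne (f x) 0 with h0 | h0
  · simp [h0, h.1]
  · rw [mul_div_cancel₀ _ h0]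

/-- Translating discrete noise, reweighted by the ratio of masses, does not increase integrals. -/
lemma HasMass.lintegral_translate_le {μ : Measure ℝ} {f : ℝ → ℝ} (h : HasMass μ f) (t : ℝ)
    (g : ℝ → ℝ≥0∞) :
    ∫⁻ x, ENNReal.ofReal (f (x + t) / f x) * g (x + t) ∂μ ≤ ∫⁻ x, g x ∂μ := by
  rw [h.lintegral_eq, h.lintegral_eq,
    tsum_subtype (Function.support f) (fun x => g x * ENNReal.ofReal (f x)),
    tsum_subtype (Function.support f)
      (fun x => ENNReal.ofReal (f (x + t) / f x) * g (x + t) * ENNReal.ofReal (f x))]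
  refine le_trans (ENNReal.tsum_le_tsum fun x => ?_)
    (ENNReal.tsum_comp_le_tsum_of_injective (add_left_injective t) _)
  by_cases hx : x ∈ Function.support f
  swap
  · simp [indicator_of_notMem hx]
  rw [indicator_of_mem hx]
  have key : ENNReal.ofReal (f (x + t) / f x) * g (x + t) * ENNReal.ofReal (f x) =
      g (x + t) * ENNReal.ofReal (f (x + t)) := by
    rw [mul_right_comm, ← ENNReal.ofReal_mul (div_nonneg (h.1 _) (h.1 _)), div_mul_cancel₀ _ hx,
      mul_comm]
  rw [key]
  by_cases h0 : x + t ∈ Function.support f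
  · rw [indicator_of_mem h0]
  · have : f (x + t) = 0 := by simpa using h0
    simp [this]

/-! ### Triangular shears of product measures -/

/-- The triangular map which adds to every coordinate a function of the preceding ones. -/
def shear (ψ : (j : ℕ) → (Fin j → ℝ) → ℝ) (k : ℕ) (y : Fin k → ℝ) : Fin k → ℝ :=
  fun j => y j + ψ j (fun l => y (Fin.castLE j.2.le l))

lemma measurable_shear {ψ : (j : ℕ) → (Fin j → ℝ) → ℝ} (hψ : ∀ j, Measurable (ψ j)) (k : ℕ) :
    Measurable (shear ψ k) := by
  unfold shear
  have := hψ
  fun_prop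

lemma shear_castSucc (ψ : (j : ℕ) → (Fin j → ℝ) → ℝ) (k : ℕ) (y : Fin (k + 1) → ℝ) (j : Fin k) :
    shear ψ (k + 1) y j.castSucc = shear ψ k (fun l => y l.castSucc) j := rfl

lemma shear_last (ψ : (j : ℕ) → (Fin j → ℝ) → ℝ) (k : ℕ) (y : Fin (k + 1) → ℝ) :
    shear ψ (k + 1) y (Fin.last k) = y (Fin.last k) + ψ k (fun l => y l.castSucc) := rfl

/-- Integration against a product of `k + 1` probability measures, the last coordinate first. -/
lemma lintegral_pi_snoc (μ : ℕ → Measure ℝ) [∀ i, IsProbabilityMeasure (μ i)] (k : ℕ)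
    {F : (Fin (k + 1) → ℝ) → ℝ≥0∞} (hF : Measurable F) :
    ∫⁻ y, F y ∂(Measure.pi fun j : Fin (k + 1) => μ j) =
      ∫⁻ y, ∫⁻ x, F (Fin.snoc y x) ∂(μ k) ∂(Measure.pi fun j : Fin k => μ j) := by
  have hmp := measurePreserving_piFinSuccAbove (fun j : Fin (k + 1) => μ j) (Fin.last k)
  have hsymm := hmp.symm
  rw [← hsymm.lintegral_comp_emb (MeasurableEquiv.measurableEmbedding _),
    lintegral_prod_symm' (fun z => F ((MeasurableEquiv.piFinSuccAbove _ _).symm z))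
      (hF.comp (MeasurableEquiv.measurable _))]
  simp only [MeasurableEquiv.piFinSuccAbove_symm_apply, Fin.insertNthEquiv_last, Fin.succAbove_last,
    Fin.val_last, Fin.val_castSucc]
  rfl

/-- If reweighted translations of the factors do not increase integrals, then neither do reweighted
triangular shears of the product measure. -/
lemma lintegral_shear_le (μ : ℕ → Measure ℝ) [∀ i, IsProbabilityMeasure (μ i)]
    {r : ℕ → ℝ → ℝ → ℝ≥0∞} (hr : ∀ i, Measurable (Function.uncurry (r i)))
    (hμ : ∀ (i : ℕ) (t : ℝ) (g : ℝ → ℝ≥0∞), Measurable g →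
      ∫⁻ x, r i x (x + t) * g (x + t) ∂(μ i) ≤ ∫⁻ x, g x ∂(μ i))
    {ψ : (j : ℕ) → (Fin j → ℝ) → ℝ} (hψ : ∀ j, Measurable (ψ j)) (k : ℕ)
    {G : (Fin k → ℝ) → ℝ≥0∞} (hG : Measurable G) :
    ∫⁻ y, (∏ j : Fin k, r j (y j) (shear ψ k y j)) * G (shear ψ k y)
        ∂(Measure.pi fun j : Fin k => μ j) ≤
      ∫⁻ y, G y ∂(Measure.pi fun j : Fin k => μ j) := by
  have hR : ∀ k, Measurable fun y : Fin k → ℝ => ∏ j : Fin k, r j (y j) (shear ψ k y j) := by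
    intro k
    refine Finset.measurable_prod _ fun j _ => ?_
    exact (hr j).comp ((measurable_pi_apply j).prodMk
      ((measurable_pi_apply j).comp (measurable_shear hψ k)))
  induction k with
  | zero =>
    refine lintegral_mono fun y => ?_
    simp [Subsingleton.elim (shear ψ 0 y) y]
  | succ k ih =>
    have hsnoc : Measurable fun q : (Fin k → ℝ) × ℝ => (Fin.snoc q.1 q.2 : Fin (k + 1) → ℝ) := by
      refine measurable_pi_iff.2 fun j => ?_
      refine Fin.lastCases ?_ (fun j => ?_) j
      · simpa using measurable_snd
      · simpa [Function.comp_def] using (measurable_pi_apply j).comp measurable_fst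
    rw [lintegral_pi_snoc μ k (F := fun y => (∏ j : Fin (k + 1), r j (y j) (shear ψ (k + 1) y j)) *
        G (shear ψ (k + 1) y)) ((hR _).mul (hG.comp (measurable_shear hψ _))),
      lintegral_pi_snoc μ k hG]
    have hshear : ∀ (y : Fin k → ℝ) (x : ℝ), shear ψ (k + 1) (Fin.snoc y x) =
        Fin.snoc (shear ψ k y) (x + ψ k y) := by
      intro y x
      ext j
      refine Fin.lastCases ?_ (fun j => ?_) j
      · simp [shear_last]
      · simp [shear_castSucc]
    have hG' : Measurable fun y : Fin k → ℝ => ∫⁻ x, G (Fin.snoc y x) ∂(μ k) :=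
      (hG.comp hsnoc).lintegral_prod_right'
    refine le_trans (lintegral_mono fun y => ?_) (ih hG')
    simp only [hshear, Fin.prod_univ_castSucc, Fin.snoc_castSucc, Fin.snoc_last,
      Fin.val_castSucc, Fin.val_last, mul_assoc]
    have hslice : Measurable fun x : ℝ => G (Fin.snoc (shear ψ k y) x) :=
      (hG.comp hsnoc).comp measurable_prodMk_left
    rw [lintegral_const_mul]
    · exact mul_le_mul_right (hμ k _ _ hslice) _
    · refine Measurable.mul ?_ (hslice.comp (measurable_add_const _))
      exact (hr k).comp (measurable_id.prodMk (measurable_add_const _))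

/-! ### Alignments of the used variables -/

section UsedVariables

variable {DB Ω : Type*} [MeasurableSpace Ω] (M : RandAlg DB Ω)

lemma measurable_firstVars (n : ℕ) : Measurable (firstVars n) :=
  measurable_pi_iff.2 fun i => measurable_pi_apply (i : ℕ)

lemma measurable_extendNoise (n : ℕ) : Measurable (extendNoise (n := n)) := by
  refine measurable_pi_iff.2 fun i => ?_
  unfold extendNoise
  split_ifs with hi
  · exact measurable_pi_apply _
  · exact measurable_const

lemma RandAlg.run_extendNoise_firstVars {D : DB} {H : ℕ → ℝ} {ω : Ω} {n : ℕ} :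
    M.run D (extendNoise (firstVars n H)) = some (ω, n) ↔ M.run D H = some (ω, n) := by
  have h : ∀ i < n, extendNoise (firstVars n H) i = H i := fun i hi => by
    simp [extendNoise, firstVars, hi]
  exact ⟨fun h1 => M.run_congr D _ _ ω n h1 fun i hi => (h i hi).symm,
    fun h1 => M.run_congr D _ _ ω n h1 h⟩

/-- The valid vectors of `n` variables on which `M` produces an output in `E`. -/
def usedNoiseEvent (p : (n : ℕ) → (Fin n → ℝ) → ℝ) (D : DB) (E : Set Ω) (n : ℕ) :
    Set (Fin n → ℝ) :=
  ⋃ ω ∈ E, usedNoiseSet M p D ω n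

lemma measurableSet_usedNoiseEvent {p : (n : ℕ) → (Fin n → ℝ) → ℝ} {n : ℕ}
    (hp : Measurable (p n)) (D : DB) {E : Set Ω} (hE : MeasurableSet E) :
    MeasurableSet (usedNoiseEvent M p D E n) := by
  have : usedNoiseEvent M p D E n = {h | 0 < p n h} ∩
      extendNoise ⁻¹' {H | ∃ ω ∈ E, M.run D H = some (ω, n)} := by
    ext h
    simp only [usedNoiseEvent, usedNoiseSet, mem_iUnion, mem_ofPred_eq, mem_inter_iff, mem_preimage]
    grind
  rw [this]
  exact (measurableSet_lt measurable_const hp).inter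
    (measurable_extendNoise n (M.measurableSet_run D E n hE))

lemma measure_run_eq_usedNoiseEvent (P : Measure (ℕ → ℝ)) {p : (n : ℕ) → (Fin n → ℝ) → ℝ} {n : ℕ}
    (hp : Measurable (p n)) (hpos : ∀ᵐ h ∂(P.map (firstVars n)), 0 < p n h) (D : DB) {E : Set Ω}
    (hE : MeasurableSet E) :
    P {H | ∃ ω ∈ E, M.run D H = some (ω, n)} =
      P.map (firstVars n) (usedNoiseEvent M p D E n) := by
  rw [Measure.map_apply (measurable_firstVars n) (measurableSet_usedNoiseEvent M hp D hE)]
  refine measure_congr ?_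
  filter_upwards [ae_of_ae_map (measurable_firstVars n).aemeasurable hpos] with H hH
  refine propext ?_
  change (∃ ω ∈ E, M.run D H = some (ω, n)) ↔ firstVars n H ∈ usedNoiseEvent M p D E n
  simp only [usedNoiseEvent, usedNoiseSet, mem_iUnion, mem_ofPred_eq,
    M.run_extendNoise_firstVars]
  grind

variable {M} {P : Measure (ℕ → ℝ)} {p : (n : ℕ) → (Fin n → ℝ) → ℝ} {D D' : DB} {a : ℝ}
  {φ : Ω → VecAlignment} {α : VecAlignment} {E : Set Ω}

lemma IsAlignmentFamily.mapsTo (h : IsAlignmentFamily M P p D D' a φ) (hE : ∀ ω ∈ E, φ ω = α)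
    (n : ℕ) : MapsTo (α n) (usedNoiseEvent M p D E n) (usedNoiseEvent M p D' E n) := by
  intro x hx
  obtain ⟨ω, hω, hx⟩ := mem_iUnion₂.1 hx
  exact mem_iUnion₂.2 ⟨ω, hω, hE ω hω ▸ h.1 ω n hx⟩

lemma IsAlignmentFamily.injOn (h : IsAlignmentFamily M P p D D' a φ) (hE : ∀ ω ∈ E, φ ω = α)
    (n : ℕ) : InjOn (α n) (usedNoiseEvent M p D E n) := by
  intro x hx y hy hxy
  obtain ⟨ω, hω, hx⟩ := mem_iUnion₂.1 hx
  obtain ⟨ω', hω', hy⟩ := mem_iUnion₂.1 hy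
  have h1 := (h.1 ω n hx).2
  have h2 := (h.1 ω' n hy).2
  rw [hE ω hω, hxy] at h1
  rw [hE ω' hω', h1, Option.some.injEq, Prod.mk.injEq] at h2
  obtain rfl := h2.1
  refine h.2.1 ω n hx hy ?_
  rwa [hE ω hω]

lemma IsAlignmentFamily.ae_le (h : IsAlignmentFamily M P p D D' a φ) (hE : ∀ ω ∈ E, φ ω = α)
    (n : ℕ) : ∀ᵐ x ∂(P.map (firstVars n)), x ∈ usedNoiseEvent M p D E n →
      p n x ≤ a * p n (α n x) := by
  filter_upwards [h.2.2.1 n] with x hx hxE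
  obtain ⟨ω, hω, hxω⟩ := mem_iUnion₂.1 hxE
  have h1 := hx ω hxω
  have h2 := (h.1 ω n hxω).1
  rw [hE ω hω] at h1 h2
  rwa [div_le_iff₀ h2] at h1

/-- The privacy bound for one alignment in the case of a density, by change of variables. -/
lemma IsAlignmentFamily.measure_le_of_hasDensity (h : IsAlignmentFamily M P p D D' a φ) {b : ℝ}
    (ha : 0 < a) (hb : 0 < b) (hJ : JacobianBound M P p D b φ) (n : ℕ)
    (hp : HasDensity (P.map (firstVars n)) (p n)) (hEm : MeasurableSet E)
    (hE : ∀ ω ∈ E, φ ω = α) :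
    P.map (firstVars n) (usedNoiseEvent M p D E n) ≤
      ENNReal.ofReal (a / b) * P.map (firstVars n) (usedNoiseEvent M p D' E n) := by
  set μ := P.map (firstVars n) with hμ
  set A := usedNoiseEvent M p D E n with hA
  have hAm : MeasurableSet A := measurableSet_usedNoiseEvent M hp.2.1 D hEm
  have hgood : ∀ᵐ x ∂μ, x ∈ A → p n x ≤ a * p n (α n x) ∧
      ∃ J : (Fin n → ℝ) →L[ℝ] (Fin n → ℝ), HasFDerivAt (α n) J x ∧ b ≤ |J.det| := by
    filter_upwards [h.ae_le hE n, hJ n] with x h1 h2 hx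
    refine ⟨h1 hx, ?_⟩
    obtain ⟨ω, hω, hxω⟩ := mem_iUnion₂.1 hx
    simpa only [hE ω hω] using h2 ω hxω
  obtain ⟨N, hbad, hNm, hN⟩ := exists_measurable_superset_of_null (ae_iff.1 hgood)
  have hG : ∀ x ∈ A \ N, p n x ≤ a * p n (α n x) ∧
      ∃ J : (Fin n → ℝ) →L[ℝ] (Fin n → ℝ), HasFDerivAt (α n) J x ∧ b ≤ |J.det| := by
    intro x hx
    by_contra hcon
    exact hx.2 (hbad fun h => hcon (h hx.1))
  choose! hle J hderiv hdet using hG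
  have hGm : MeasurableSet (A \ N) := hAm.diff hNm
  have hinj : InjOn (α n) (A \ N) := (h.injOn hE n).mono sdiff_subset
  have himage : α n '' (A \ N) ⊆ usedNoiseEvent M p D' E n :=
    ((h.mapsTo hE n).mono_left sdiff_subset).image_subset
  have hdens : ∀ s, MeasurableSet s → μ s = ∫⁻ x in s, ENNReal.ofReal (p n x) := by
    intro s hs
    rw [hp.2.2, withDensity_apply _ hs]
  calc μ A = μ (A \ N) := (measure_sdiff_null hN).symm
    _ = ∫⁻ x in A \ N, ENNReal.ofReal (p n x) := hdens _ hGm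
    _ ≤ ∫⁻ x in A \ N, ENNReal.ofReal (a / b) *
          (ENNReal.ofReal |(J x).det| * ENNReal.ofReal (p n (α n x))) := by
        refine setLIntegral_mono' hGm fun x hx => ?_
        rw [← ENNReal.ofReal_mul (abs_nonneg _), ← ENNReal.ofReal_mul (by positivity)]
        refine ENNReal.ofReal_le_ofReal ((hle x hx).trans ?_)
        have h1 : b * p n (α n x) ≤ |(J x).det| * p n (α n x) :=
          mul_le_mul_of_nonneg_right (hdet x hx) (hp.1 _)
        calc a * p n (α n x) = a / b * (b * p n (α n x)) := by field_simp
          _ ≤ _ := by gcongr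
    _ = ENNReal.ofReal (a / b) * ∫⁻ x in α n '' (A \ N), ENNReal.ofReal (p n x) := by
        rw [lintegral_const_mul' _ _ ENNReal.ofReal_ne_top,
          lintegral_image_eq_lintegral_abs_det_fderiv_mul volume hGm
            (fun x hx => (hderiv x hx).hasFDerivWithinAt) hinj]
    _ ≤ _ := by
        rw [hdens _ (measurableSet_usedNoiseEvent M hp.2.1 D' hEm)]
        gcongr

/-- The privacy bound for one alignment in the discrete case. -/
lemma IsAlignmentFamily.measure_le_of_hasMass (h : IsAlignmentFamily M P p D D' a φ)
    (ha : 0 < a) (n : ℕ) (hp : HasMass (P.map (firstVars n)) (p n)) (hE : ∀ ω ∈ E, φ ω = α) :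
    P.map (firstVars n) (usedNoiseEvent M p D E n) ≤
      ENNReal.ofReal a * P.map (firstVars n) (usedNoiseEvent M p D' E n) := by
  have hpos : ∀ D, ∀ x ∈ usedNoiseEvent M p D E n, 0 < p n x := by
    intro D x hx
    obtain ⟨ω, -, hx⟩ := mem_iUnion₂.1 hx
    exact hx.1
  rw [hp.measure_eq fun x hx => (hpos D x hx).ne', hp.measure_eq fun x hx => (hpos D' x hx).ne',
    ← ENNReal.tsum_mul_left]
  have hle : ∀ x ∈ usedNoiseEvent M p D E n, p n x ≤ a * p n (α n x) := by
    intro x hx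
    by_contra hcon
    have hnull : P.map (firstVars n) {x} = 0 := by
      refine measure_mono_null ?_ (ae_iff.1 (h.ae_le hE n))
      rintro _ rfl hx'
      exact hcon (hx' hx)
    rw [hp.2.2.2, ENNReal.ofReal_eq_zero] at hnull
    exact absurd (hpos D x hx) hnull.not_gt
  refine le_trans (ENNReal.tsum_le_tsum fun x => ?_)
    (ENNReal.tsum_comp_le_tsum_of_injective (h.mapsTo hE n |>.restrict_inj.2 (h.injOn hE n)) _)
  rw [← ENNReal.ofReal_mul ha.le]
  exact ENNReal.ofReal_le_ofReal (hle x x.2)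

end UsedVariables

/-! ### Acyclic alignments -/

lemma PiecewiseDifferentiable.measurable {n : ℕ} {g : (Fin n → ℝ) → ℝ}
    (hg : PiecewiseDifferentiable g) : Measurable g := by
  obtain ⟨A, hA, hU, hd⟩ := hg
  intro s hs
  have : g ⁻¹' s = ⋃ k, Subtype.val '' ((A k).domRestrict g ⁻¹' s) := by
    ext x
    obtain ⟨k, hk⟩ := mem_iUnion.1 (hU ▸ mem_univ x)
    simp only [mem_preimage, mem_iUnion, mem_image, Subtype.exists, domRestrict_apply]
    grind
  rw [this]
  refine MeasurableSet.iUnion fun k => MeasurableSet.subtype_image (hA k) ?_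
  exact (continuousOn_iff_continuous_domRestrict.1 (hd k).continuousOn).measurable hs

lemma ae_mem_validNoise (μ : ℕ → Measure ℝ) [∀ i, IsProbabilityMeasure (μ i)] {f : ℕ → ℝ → ℝ}
    (hf : ∀ i, HasDensity (μ i) (f i) ∨ HasMass (μ i) (f i)) :
    ∀ᵐ H ∂(Measure.infinitePi μ), H ∈ ValidNoise f := by
  refine ae_all_iff.2 fun i => ?_
  have : ∀ᵐ x ∂(μ i), 0 < f i x := (hf i).elim (fun h => h.ae_pos) fun h => h.ae_pos
  rw [← Measure.infinitePi_map_eval μ i] at this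
  exact ae_of_ae_map (measurable_pi_apply i).aemeasurable this

/-- An acyclic map of cost at most `ε` between events which, among the valid noise sequences, are
determined by finitely many variables increases probabilities at most by the factor `exp ε`. -/
lemma measure_le_of_isAcyclic (μ : ℕ → Measure ℝ) [∀ i, IsProbabilityMeasure (μ i)]
    {f : ℕ → ℝ → ℝ} {c : ℕ → ℝ} {ε : ℝ} (hε : 0 ≤ ε)
    (hf : ∀ i, HasDensity (μ i) (f i) ∨ HasMass (μ i) (f i))
    (hc : ∀ i x y, 0 < f i x → 0 < f i y → Real.log (f i x / f i y) ≤ c i * |x - y|)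
    {A B : Set (ℕ → ℝ)} (hA : MeasurableSet A) (hB : MeasurableSet B)
    (hAv : A ⊆ ValidNoise f) (hBv : B ⊆ ValidNoise f) {m : ℕ}
    (hAm : ∀ H ∈ A, ∀ H' ∈ ValidNoise f, (∀ i < m, H' i = H i) → H' ∈ A)
    (hBm : ∀ H ∈ B, ∀ H' ∈ ValidNoise f, (∀ i < m, H' i = H i) → H' ∈ B)
    {φ : (ℕ → ℝ) → (ℕ → ℝ)} (hφ : IsAcyclic φ) (hmaps : MapsTo φ A B)
    (hcost : ∀ H ∈ A, alignCost c H (φ H) ≤ ENNReal.ofReal ε) :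
    Measure.infinitePi μ A ≤ ENNReal.ofReal (Real.exp ε) * Measure.infinitePi μ B := by
  obtain ⟨π, ψ, hψ, hπ⟩ := hφ
  have hfm : ∀ i, Measurable (f i) := fun i => (hf i).elim (fun h => h.2.1) fun h => h.measurable
  have hvalid := ae_mem_validNoise μ hf
  obtain ⟨Z, hZ⟩ := hvalid.exists
  obtain ⟨k, hk⟩ : ∃ k, ∀ i < m, π.symm i < k := by
    refine ⟨(Finset.range m).sup (fun i => π.symm i) + 1, fun i hi => Nat.lt_succ_of_le ?_⟩
    exact Finset.le_sup (f := fun i => π.symm i) (Finset.mem_range.2 hi)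
  let Y : (ℕ → ℝ) → (Fin k → ℝ) := fun H j => H (π j)
  let e : (Fin k → ℝ) → (ℕ → ℝ) := fun y i => if h : π.symm i < k then y ⟨π.symm i, h⟩ else Z i
  have hYm : Measurable Y := by fun_prop
  have hem : Measurable e := by
    refine measurable_pi_iff.2 fun i => ?_
    simp only [e]
    split_ifs
    · exact measurable_pi_apply _
    · exact measurable_const
  have heπ : ∀ y (j : Fin k), e y (π j) = y j := fun y j => by simp [e]
  have hYe : ∀ y, Y (e y) = y := fun y => funext fun j => heπ y j
  have heY : ∀ H, ∀ i < m, e (Y H) i = H i := fun H i hi => by simp [e, Y, hk i hi]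
  have heYv : ∀ H ∈ ValidNoise f, e (Y H) ∈ ValidNoise f := by
    intro H hH i
    by_cases hi : π.symm i < k
    · simpa [e, Y, hi] using hH i
    · simpa [e, hi] using hZ i
  have hshear : ∀ H, shear ψ k (Y H) = Y (φ H) := fun H => funext fun j => (hπ H j).symm
  have hψm : ∀ j, Measurable (ψ j) := fun j => (hψ j).measurable
  let r : ℕ → ℝ → ℝ → ℝ≥0∞ := fun i x y => ENNReal.ofReal (f (π i) y / f (π i) x)
  have hr : ∀ i, Measurable (Function.uncurry (r i)) := fun i =>
    (((hfm _).comp measurable_snd).div ((hfm _).comp measurable_fst)).ennreal_ofReal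
  have hμr : ∀ (i : ℕ) (t : ℝ) (g : ℝ → ℝ≥0∞), Measurable g →
      ∫⁻ x, r i x (x + t) * g (x + t) ∂(μ (π i)) ≤ ∫⁻ x, g x ∂(μ (π i)) := fun i t g hg =>
    (hf (π i)).elim (fun h => h.lintegral_translate_le t hg) fun h => h.lintegral_translate_le t g
  have hmap : (Measure.infinitePi μ).map Y = Measure.pi fun j : Fin k => μ (π j) := by
    rw [← Measure.infinitePi_eq_pi]
    exact Measure.map_infinitePi_infinitePi_of_inj (π.injective.comp Fin.val_injective)
  have hshearAB : MapsTo (shear ψ k) (e ⁻¹' A) (e ⁻¹' B) := by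
    intro y hy
    have hφB : φ (e y) ∈ B := hmaps hy
    have := hshear (e y)
    rw [hYe] at this
    rw [mem_preimage, this]
    exact hBm _ hφB _ (heYv _ (hBv hφB)) (heY _)
  have hweight : ∀ y ∈ e ⁻¹' A, 1 ≤ ENNReal.ofReal (Real.exp ε) *
      ∏ j : Fin k, r j (y j) (shear ψ k y j) := by
    intro y hy
    have hv := hAv hy
    have hv' := hBv (hmaps hy)
    have hy' : shear ψ k y = Y (φ (e y)) := by rw [← hshear, hYe]
    have hsum : ∑ j : Fin k, c (π j) * |e y (π j) - φ (e y) (π j)| ≤ ε := by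
      rw [← ENNReal.ofReal_le_ofReal_iff hε]
      refine (Finset.le_sum_of_subadditive _ ENNReal.ofReal_zero.le
        (fun _ _ => ENNReal.ofReal_add_le) _ _).trans (le_trans ?_ (hcost _ hy))
      rw [← tsum_fintype (L := .unconditional _)]
      exact ENNReal.tsum_comp_le_tsum_of_injective (π.injective.comp Fin.val_injective)
        fun i => ENNReal.ofReal (c i * |e y i - φ (e y) i|)
    have hterm : ∀ j : Fin k, Real.exp (-(c (π j) * |e y (π j) - φ (e y) (π j)|)) ≤
        f (π j) (shear ψ k y j) / f (π j) (y j) := by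
      intro j
      have h1 := hv (π j)
      have h2 := hv' (π j)
      have h3 := hc _ _ _ h1 h2
      rw [hy', ← heπ y j]
      rw [← inv_div, Real.log_inv] at h3
      calc _ ≤ Real.exp (Real.log (f (π j) (φ (e y) (π j)) / f (π j) (e y (π j)))) :=
            Real.exp_le_exp.2 (by linarith)
        _ = _ := Real.exp_log (div_pos h2 h1)
    rw [← ENNReal.ofReal_prod_of_nonneg fun j _ => (Real.exp_pos _).le.trans (hterm j),
      ← ENNReal.ofReal_mul (Real.exp_pos _).le, ENNReal.one_le_ofReal]
    calc (1 : ℝ) ≤ Real.exp ε *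
          Real.exp (∑ j : Fin k, -(c (π j) * |e y (π j) - φ (e y) (π j)|)) := by
          rw [← Real.exp_add, Finset.sum_neg_distrib]
          exact Real.one_le_exp (by linarith)
      _ ≤ _ := by
          rw [Real.exp_sum]
          gcongr with j
          exact hterm j
  have hind : Measurable ((e ⁻¹' B).indicator (1 : (Fin k → ℝ) → ℝ≥0∞)) :=
    measurable_one.indicator (hem hB)
  calc Measure.infinitePi μ A ≤ Measure.infinitePi μ (Y ⁻¹' (e ⁻¹' A)) :=
        measure_mono fun H hH => hAm H hH _ (heYv H (hAv hH)) (heY H)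
    _ = ∫⁻ y in e ⁻¹' A, 1 ∂(Measure.pi fun j : Fin k => μ (π j)) := by
        rw [← Measure.map_apply hYm (hem hA), hmap, setLIntegral_one]
    _ ≤ ∫⁻ y in e ⁻¹' A, ENNReal.ofReal (Real.exp ε) *
          ((∏ j : Fin k, r j (y j) (shear ψ k y j)) *
            (e ⁻¹' B).indicator (1 : (Fin k → ℝ) → ℝ≥0∞) (shear ψ k y))
          ∂(Measure.pi fun j : Fin k => μ (π j)) := by
        refine setLIntegral_mono' (hem hA) fun y hy => ?_
        rw [indicator_of_mem (hshearAB hy), Pi.one_apply, mul_one]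
        exact hweight y hy
    _ ≤ ENNReal.ofReal (Real.exp ε) * ∫⁻ y, (e ⁻¹' B).indicator 1 y
          ∂(Measure.pi fun j : Fin k => μ (π j)) := by
        refine (setLIntegral_le_lintegral _ _).trans ?_
        rw [lintegral_const_mul' _ _ ENNReal.ofReal_ne_top]
        exact mul_le_mul_right (lintegral_shear_le (fun i => μ (π i)) hr hμr hψm k hind) _
    _ = ENNReal.ofReal (Real.exp ε) * Measure.infinitePi μ (Y ⁻¹' (e ⁻¹' B)) := by
        rw [lintegral_indicator_one (hem hB), ← hmap, Measure.map_apply hYm (hem hB)]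
    _ ≤ _ := by
        refine mul_le_mul_right (measure_mono_ae ?_) _
        filter_upwards [hvalid] with H hH hHB
        exact hBm _ hHB H hH fun i hi => (heY H i hi).symm

lemma measurableSet_validNoise {f : ℕ → ℝ → ℝ} (hf : ∀ i, Measurable (f i)) :
    MeasurableSet (ValidNoise f) := by
  have : ValidNoise f = ⋂ i, {H | 0 < f i (H i)} := by
    ext H; simp [ValidNoise]
  rw [this]
  exact MeasurableSet.iInter fun i =>
    measurableSet_lt measurable_const ((hf i).comp (measurable_pi_apply i))

lemma RandAlg.isDP_of_acyclic {DB Ω : Type*} [MeasurableSpace Ω] {adj : DB → DB → Prop}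
    (M : RandAlg DB Ω) (hcount : M.CountDetermined)
    (μ : ℕ → Measure ℝ) [∀ i, IsProbabilityMeasure (μ i)]
    {f : ℕ → ℝ → ℝ} {c : ℕ → ℝ} {ε : ℝ} (hε : 0 ≤ ε)
    (hf : ∀ i, HasDensity (μ i) (f i) ∨ HasMass (μ i) (f i))
    (hc : ∀ i x y, 0 < f i x → 0 < f i y → Real.log (f i x / f i y) ≤ c i * |x - y|)
    (hφ : ∀ D D', adj D D' → ∃ φ : Ω → (ℕ → ℝ) → (ℕ → ℝ),
      (∀ ω, IsLocalAlignment M f D D' ω (φ ω) ∧ IsAcyclic (φ ω) ∧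
        ∀ H ∈ noiseSet M f D ω, alignCost c H (φ ω H) ≤ ENNReal.ofReal ε) ∧
      CountablyManyAlignments φ) :
    M.IsDP (Measure.infinitePi μ) adj ε := by
  intro D D' hadj E hE
  obtain ⟨φ, hφ, hφc⟩ := hφ D D' hadj
  obtain ⟨N, hN⟩ := hcount
  refine M.measure_outputs_le _ D D' _ hφc (fun α n E hE hα => ?_) hE
  rcases E.eq_empty_or_nonempty with rfl | ⟨ω₀, hω₀⟩
  · simp
  have hfm : ∀ i, Measurable (f i) := fun i => (hf i).elim (fun h => h.2.1) fun h => h.measurable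
  have hvalid := ae_mem_validNoise μ hf
  let A : DB → Set (ℕ → ℝ) := fun D => ValidNoise f ∩ {H | ∃ ω ∈ E, M.run D H = some (ω, n)}
  have hAm : ∀ D, MeasurableSet (A D) := fun D =>
    (measurableSet_validNoise hfm).inter (M.measurableSet_run D E n hE)
  have hAn : ∀ D, ∀ H ∈ A D, ∀ H' ∈ ValidNoise f, (∀ i < n, H' i = H i) → H' ∈ A D := by
    rintro D H ⟨-, ω, hω, h1⟩ H' hH' h2
    exact ⟨hH', ω, hω, M.run_congr D _ _ ω n h1 h2⟩
  have hmaps : MapsTo α (A D) (A D') := by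
    rintro H ⟨hH, ω, hω, h1⟩
    obtain ⟨hv, m, hm⟩ := (hφ ω).1 ⟨hH, n, h1⟩
    rw [hα ω hω] at hv hm
    obtain rfl : m = n := (hN _ _ _ _ hm).trans (hN _ _ _ _ h1).symm
    exact ⟨hv, ω, hω, hm⟩
  have hcost : ∀ H ∈ A D, alignCost c H (α H) ≤ ENNReal.ofReal ε := by
    rintro H ⟨hH, ω, hω, h1⟩
    have := (hφ ω).2.2 H ⟨hH, n, h1⟩
    rwa [hα ω hω] at this
  calc Measure.infinitePi μ {H | ∃ ω ∈ E, M.run D H = some (ω, n)}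
      ≤ Measure.infinitePi μ (A D) := measure_mono_ae (by
        filter_upwards [hvalid] with H hH h1
        exact ⟨hH, h1⟩)
    _ ≤ ENNReal.ofReal (Real.exp ε) * Measure.infinitePi μ (A D') :=
        measure_le_of_isAcyclic μ hε hf hc (hAm D) (hAm D') inter_subset_left inter_subset_left
          (hAn D) (hAn D') (hα ω₀ hω₀ ▸ (hφ ω₀).2.1) hmaps hcost
    _ ≤ _ := by
        gcongr
        exact inter_subset_right

theorem lemma1 {DB Ω : Type*} [MeasurableSpace Ω] (adj : DB → DB → Prop) (M : RandAlg DB Ω)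
    (hcount : M.CountDetermined) :
    -- acyclic local alignments of bounded cost
    (∀ (μ : ℕ → Measure ℝ) [∀ i, IsProbabilityMeasure (μ i)] (f : ℕ → ℝ → ℝ) (c : ℕ → ℝ) (ε : ℝ),
      0 < ε →
      M.Terminates (Measure.infinitePi μ) →
      (∀ i, HasDensity (μ i) (f i) ∨ HasMass (μ i) (f i)) →
      (∀ i x y, 0 < f i x → 0 < f i y → Real.log (f i x / f i y) ≤ c i * |x - y|) →
      (∀ D D', adj D D' → ∃ φ : Ω → (ℕ → ℝ) → (ℕ → ℝ),
        (∀ ω, IsLocalAlignment M f D D' ω (φ ω) ∧ IsAcyclic (φ ω) ∧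
          ∀ H ∈ noiseSet M f D ω, alignCost c H (φ ω H) ≤ ENNReal.ofReal ε) ∧
        CountablyManyAlignments φ) →
      M.IsDP (Measure.infinitePi μ) adj ε) ∧
    -- general alignments, noise with a density
    (∀ (P : Measure (ℕ → ℝ)) [IsProbabilityMeasure P] (p : (n : ℕ) → (Fin n → ℝ) → ℝ) (a b : ℝ),
      0 < a → 0 < b →
      M.Terminates P →
      (∀ n, HasDensity (P.map (firstVars n)) (p n)) →
      (∀ D D', adj D D' → ∃ φ : Ω → VecAlignment,
        IsAlignmentFamily M P p D D' a φ ∧ JacobianBound M P p D b φ) →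
      M.IsDP P adj (Real.log (a / b))) ∧
    -- general alignments, discrete noise
    (∀ (P : Measure (ℕ → ℝ)) [IsProbabilityMeasure P] (p : (n : ℕ) → (Fin n → ℝ) → ℝ) (a : ℝ),
      0 < a →
      M.Terminates P →
      (∀ n, HasMass (P.map (firstVars n)) (p n)) →
      (∀ D D', adj D D' → ∃ φ : Ω → VecAlignment, IsAlignmentFamily M P p D D' a φ) →
      M.IsDP P adj (Real.log a)) := by
  refine ⟨fun μ _ f c ε hε _ hf hc hφ => M.isDP_of_acyclic hcount μ hε.le hf hc hφ, ?_, ?_⟩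
  · intro P _ p a b ha hb _ hp hφ D D' hadj E hE
    obtain ⟨φ, h, hJ⟩ := hφ D D' hadj
    rw [Real.exp_log (div_pos ha hb)]
    refine M.measure_outputs_le P D D' _ h.2.2.2 (fun α n E hE hα => ?_) hE
    rw [measure_run_eq_usedNoiseEvent M P (hp n).2.1 (hp n).ae_pos D hE,
      measure_run_eq_usedNoiseEvent M P (hp n).2.1 (hp n).ae_pos D' hE]
    exact h.measure_le_of_hasDensity ha hb hJ n (hp n) hE hα
  · intro P _ p a ha _ hp hφ D D' hadj E hE
    obtain ⟨φ, h⟩ := hφ D D' hadj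
    rw [Real.exp_log ha]
    refine M.measure_outputs_le P D D' _ h.2.2.2 (fun α n E hE hα => ?_) hE
    rw [measure_run_eq_usedNoiseEvent M P (hp n).measurable (hp n).ae_pos D hE,
      measure_run_eq_usedNoiseEvent M P (hp n).measurable (hp n).ae_pos D' hE]
    exact h.measure_le_of_hasMass ha n (hp n) hα
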